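/- Let $d,q,k\ge 1$ be integers, $m=\max\{d,q\}$, $T>0$, $w,\tilde w\in(0,\infty)$ and $A\ge 0$. All spaces $\mathbb{R}^n$ carry the maximum norm $\|\cdot\|_\infty$, matrices the induced operator norm, and $C([-\tau,0],\mathbb{R}^m)$ the supremum norm. For a delay $\tau\in[0,T]$, a non-augmented neural DDE is a map $\Phi_\theta:\mathbb{R}^d\to\mathbb{R}^q$, $\Phi_\theta(x)=\widetilde W h(T)+\tilde b$, where $h$ is the solution of $$h'(t)=F(t,h_t)\quad (t\in[0,T]),\qquad h(s)=Wx+b\quad (s\in[-\tau,0]),\qquad h_t(s)=h(t+s).$$ Here $W\in\mathbb{R}^{m\times d}$ and $\widetilde W\in\mathbb{R}^{q\times m}$ have full rank, $b\in\mathbb{R}^m$, $\tilde b\in\mathbb{R}^q$, and $F:[0,T]\times C([-\tau,0],\mathbb{R}^m)\to\mathbb{R}^m$ is continuous in the first variable and $k$ times continuously differentiable in the second one, with bounded derivatives of orders $1,\dots,k$ with respect to the second variable. We say that $F$ is $K$-Lipschitz if $F(t,\cdot)$ is Lipschitz continuous with constant $K$ for every $t\in[0,T]$. (a) There exists a continuous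 function $\tau_0:(0,\infty)\to(0,T]$ with $K\tau_0(K)e<1$ for all $K\in(0,\infty)$ such that for all $K\in(0,\infty)$, all $\tau\in[0,\tau_0(K))$ and all integers $j\ge 0$, the class of all non-augmented neural DDEs with delay $\tau$ and $K$-Lipschitz $F$, with $\|F(t,0)\|_\infty\le A$ for all $t\in[0,T]$, $\|W\|_\infty\le w$ and $\|\widetilde W\|_\infty\le\tilde w$, does not have the universal approximation property with respect to $C^j(\mathbb{R}^d,\mathbb{R}^q)$. That is, it is not true that for every $\varepsilon>0$ and every $\Psi\in C^j(\mathbb{R}^d,\mathbb{R}^q)$ some $\Phi_\theta$ of this class satisfies $\|\Phi_\theta(x)-\Psi(x)\|_\infty<\varepsilon$ for all $x\in\mathbb{R}^d$. (b) Let $\Psi:\mathbb{R}^d\to\mathbb{R}^q$ be $k$ times continuously differentiable with bounded derivatives of orders $1,\dots,k$, and Lipschitz continuous with constant $K_\Psi\geq 0$. Let $K\ge 0$ and $\tau\in[0,T]$ satisfy $$K\tau\ \ge\ 2\left(1+\frac{K_\Psi}{w\tilde w}\right).$$ Then $\Psi=\Phi_\theta$ for some non-augmented neural DDE with delay $\tau$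 and $K$-Lipschitz $F$, with $\|W\|_\infty=w$, $\|\widetilde W\|_\infty=\tilde w$ and $\|F(t,0)\|_\infty\le A$ for all $t\in[0,T]$. -/

import Mathlib

open Set
open scoped NNReal

-- On matrices, `‖·‖` is the operator norm induced by the maximum norm (the maximal absolute row
-- sum).  The spaces `Fin n → ℝ` carry the maximum norm.
attribute [local instance] Matrix.linftyOpNormedAddCommGroup

namespace NeuralDelay

/-- The state space `C([-τ,0], ℝ^m)` of the delay equation, with the supremum norm. -/
abbrev History (τ : ℝ) (m : ℕ) : Type := C(Icc (-τ) (0 : ℝ), Fin m → ℝ)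

/-- The delayed function `h_t`, given by `h_t(s) = h(t+s)` for `s ∈ [-τ,0]`. -/
def segment (τ : ℝ) {m : ℕ} (h : C(ℝ, Fin m → ℝ)) (t : ℝ) : History τ m where
  toFun s := h (t + s)
  continuous_toFun := by fun_prop

/-- `h` solves `h'(t) = F(t, h_t)` on `[0,T]` (with one-sided derivatives at the endpoints) with
the constant initial function `h = y` on `[-τ,0]`.  Only the restriction of `h` to `[-τ,T]` is
constrained; every continuous function on that interval extends continuously to `ℝ`. -/
def IsSolution (τ T : ℝ) {m : ℕ} (F : ℝ → History τ m → (Fin m → ℝ)) (y : Fin m → ℝ)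
    (h : C(ℝ, Fin m → ℝ)) : Prop :=
  (∀ s ∈ Icc (-τ) (0 : ℝ), h s = y) ∧
    ∀ t ∈ Icc (0 : ℝ) T, HasDerivWithinAt h (F t (segment τ h t)) (Icc 0 T) t

/-- `Ψ` is `k` times continuously differentiable and its derivatives of the orders `1, …, k`
are bounded (`Ψ` itself need not be bounded). -/
def IsCkb {d q : ℕ} (k : ℕ) (Ψ : (Fin d → ℝ) → (Fin q → ℝ)) : Prop :=
  ContDiff ℝ k Ψ ∧
    ∀ i : ℕ, 1 ≤ i → i ≤ k → ∃ C : ℝ, ∀ x, ‖iteratedFDeriv ℝ i Ψ x‖ ≤ C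

/-- `F ∈ C^{0,k}_b([0,T] × C([-τ,0],ℝ^m), ℝ^m)`: continuous in the first variable, `k` times
continuously differentiable in the second variable, with derivatives of the orders `1, …, k` with
respect to the second variable that are bounded on `[0,T] × C([-τ,0],ℝ^m)`. -/
def IsC0kb {τ : ℝ} {m : ℕ} (T : ℝ) (k : ℕ) (F : ℝ → History τ m → (Fin m → ℝ)) : Prop :=
  (∀ φ, ContinuousOn (fun t => F t φ) (Icc 0 T)) ∧
  (∀ t ∈ Icc (0 : ℝ) T, ContDiff ℝ k (F t)) ∧
    ∀ i : ℕ, 1 ≤ i → i ≤ k →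
      ∃ C : ℝ, ∀ t ∈ Icc (0 : ℝ) T, ∀ φ, ‖iteratedFDeriv ℝ i (F t) φ‖ ≤ C

/-- The parameters of a neural DDE `ℝ^d → ℝ^q` with an `m`-dimensional delay equation of
delay `τ`: the affine layers `x ↦ W x + b` and `y ↦ W' y + b'`, and the vector field `F`
(of which only the values for times in `[0,T]` matter). -/
structure Parameters (d q m : ℕ) (τ : ℝ) where
  W : Matrix (Fin m) (Fin d) ℝ
  b : Fin m → ℝ
  W' : Matrix (Fin q) (Fin m) ℝ
  b' : Fin q → ℝ
  F : ℝ → History τ m → (Fin m → ℝ)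

variable {d q m : ℕ} {τ : ℝ}

/-- `Φ` is the input-output map of the neural DDE: `Φ x = W' h(T) + b'`, where `h` is the solution
with constant initial function `W x + b`.  For `F ∈ C^{0,k}_b` with `k ≥ 1` the vector field
is Lipschitz in the second variable, so that `h` is unique on `[-τ,T]`. -/
def Parameters.Represents (θ : Parameters d q m τ) (T : ℝ)
    (Φ : (Fin d → ℝ) → (Fin q → ℝ)) : Prop :=
  ∀ x, ∃ h : C(ℝ, Fin m → ℝ),
    IsSolution τ T θ.F (θ.W.mulVec x + θ.b) h ∧ Φ x = θ.W'.mulVec (h T) + θ.b'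

/-- Non-augmented architecture: `m ≤ max {d, q}`, and both weight matrices have full rank. -/
def Parameters.NonAugmented (θ : Parameters d q m τ) : Prop :=
  m ≤ max d q ∧ θ.W.rank = min m d ∧ θ.W'.rank = min q m

/-- The vector field has Lipschitz constant `K` in the second variable. -/
def Parameters.LipschitzField (θ : Parameters d q m τ) (T : ℝ) (K : ℝ≥0) : Prop :=
  ∀ t ∈ Icc (0 : ℝ) T, LipschitzWith K (θ.F t)

/-- `‖F(t,0)‖ ≤ A` for all `t ∈ [0,T]`. -/
def Parameters.FieldBoundAtZero (θ : Parameters d q m τ) (T A : ℝ) : Prop :=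
  ∀ t ∈ Icc (0 : ℝ) T, ‖θ.F t 0‖ ≤ A

/-- A class `N` of maps `ℝ^d → ℝ^q` has the universal approximation property with respect to
`C^j(ℝ^d, ℝ^q)`. -/
def UniversalApproximation (N : Set ((Fin d → ℝ) → (Fin q → ℝ))) (j : ℕ) : Prop :=
  ∀ ε : ℝ, 0 < ε → ∀ Ψ : (Fin d → ℝ) → (Fin q → ℝ), ContDiff ℝ j Ψ →
    ∃ Φ ∈ N, ∀ x, dist (Φ x) (Ψ x) < ε

end NeuralDelay

/-! (a) A Grönwall estimate shows that every map of the class is Lipschitz with one constant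
determined by `w`, `w'`, `K`, `T` (`Parameters.Represents.dist_le`). A linear map of larger slope
leaves every such map at unbounded distance, so it cannot be approximated uniformly. The constant is
uniform in the delay, so `τ₀` need only be continuous and small enough.

(b) The delay serves as memory. The field vanishes until time `T - τ`; from then until `T` the value
`h(t - τ)` is still the initial value `y`, so `h' = a(t) g(y)` integrates explicitly to `h(T) = y +
g(y)` when `a` has integral 1 (`exists_isSolution_ramp`). Any `g` may thus be prescribed, and
`displacement` is the one that produces `Ψ`. The ramp `a` is continuous with peak `2/τ`, and `g` has
Lipschitz constant `1 + KΨ/(w w')`; their product is at most `K` exactly under the stated condition.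
-/

namespace NeuralDelay

/-! ### Uniform Lipschitz bound and failure of approximation -/

section Gronwall

/-- Two solutions of a delay equation with a Lipschitz right-hand side depend Lipschitz
continuously on their constant initial functions. -/
theorem IsSolution.dist_le {τ T : ℝ} (hτ : 0 ≤ τ) (hT : 0 ≤ T) {m : ℕ}
    {F : ℝ → History τ m → (Fin m → ℝ)} {K : ℝ≥0} (hK : 0 < K)
    (hF : ∀ t ∈ Icc (0 : ℝ) T, LipschitzWith K (F t))
    {y₁ y₂ : Fin m → ℝ} {h₁ h₂ : C(ℝ, Fin m → ℝ)}
    (H₁ : IsSolution τ T F y₁ h₁) (H₂ : IsSolution τ T F y₂ h₂) :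
    dist (h₁ T) (h₂ T) ≤ 2 * (1 + K * T) * Real.exp (2 * K * T) * dist y₁ y₂ := by
  have hK' : (0 : ℝ) < K := hK
  set D : ℝ := dist y₁ y₂ with hD
  have hD0 : 0 ≤ D := dist_nonneg
  -- Weighted supremum norm: the rate `2K` makes the integrated Lipschitz term contribute only half
  -- of the maximum `N`, which can then be absorbed.
  set g : ℝ → ℝ := fun t => Real.exp (-(2 * K * t)) * ‖h₁ t - h₂ t‖ with hg
  have hgc : Continuous g := by rw [hg]; fun_prop
  obtain ⟨t₀, ht₀, hmax⟩ :=
    isCompact_Icc.exists_isMaxOn (nonempty_Icc.2 hT) hgc.continuousOn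
  set N : ℝ := g t₀ with hN
  have hN0 : 0 ≤ N := by rw [hN, hg]; positivity
  have hle : ∀ t ∈ Icc (0 : ℝ) T, ‖h₁ t - h₂ t‖ ≤ N * Real.exp (2 * K * t) := by
    intro t ht
    have h : g t ≤ N := hmax ht
    have : ‖h₁ t - h₂ t‖ = g t * Real.exp (2 * K * t) := by
      simp only [hg]
      rw [mul_right_comm, ← Real.exp_add]
      simp
    rw [this]
    gcongr
  have hseg : ∀ t ∈ Icc (0 : ℝ) T,
      dist (segment τ h₁ t) (segment τ h₂ t) ≤ D + N * Real.exp (2 * K * t) := by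
    intro t ht
    rw [ContinuousMap.dist_le (by positivity)]
    intro s
    change dist (h₁ (t + s)) (h₂ (t + s)) ≤ _
    have hs := s.2
    rcases le_total (t + s) 0 with h | h
    · have hmem : t + (s : ℝ) ∈ Icc (-τ) (0 : ℝ) := ⟨by linarith [hs.1, ht.1], h⟩
      rw [H₁.1 _ hmem, H₂.1 _ hmem]
      exact le_add_of_nonneg_right (by positivity)
    · rw [dist_eq_norm]
      refine (hle _ ⟨h, by linarith [hs.2, ht.2]⟩).trans ?_
      have : N * Real.exp (2 * K * (t + s)) ≤ N * Real.exp (2 * K * t) := by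
        gcongr
        linarith [hs.2]
      linarith
  have h0 : h₁ 0 - h₂ 0 = y₁ - y₂ := by
    have : (0 : ℝ) ∈ Icc (-τ) (0 : ℝ) := ⟨by linarith, le_rfl⟩
    rw [H₁.1 _ this, H₂.1 _ this]
  have key := image_norm_le_of_norm_deriv_right_le_deriv_boundary
    (f := fun t => h₁ t - h₂ t)
    (f' := fun t => F t (segment τ h₁ t) - F t (segment τ h₂ t)) (a := 0) (b := T)
    -- `B` is an antiderivative of `B'`, which is `K` times the bound on the segments.
    (B := fun t => D + K * D * t + N / 2 * Real.exp (2 * K * t))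
    (B' := fun t => K * (D + N * Real.exp (2 * K * t)))
    (by fun_prop)
    (fun t ht => by
      have h : HasDerivWithinAt (fun t => h₁ t - h₂ t)
          (F t (segment τ h₁ t) - F t (segment τ h₂ t)) (Icc 0 T) t :=
        (H₁.2 t ⟨ht.1, ht.2.le⟩).sub (H₂.2 t ⟨ht.1, ht.2.le⟩)
      exact h.mono_of_mem_nhdsWithin (Icc_mem_nhdsGE_of_mem ht))
    (by
      simp only [h0, ← dist_eq_norm, ← hD]
      have : (0 : ℝ) ≤ N / 2 * Real.exp (2 * K * 0) := by positivity
      linarith)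
    (fun t => by
      have h1 : HasDerivAt (fun t : ℝ => Real.exp (2 * K * t))
          (Real.exp (2 * K * t) * (2 * K * 1)) t :=
        ((hasDerivAt_id t).const_mul (2 * (K : ℝ))).exp
      have h2 := (((hasDerivAt_id t).const_mul (K * D)).const_add D).add (h1.const_mul (N / 2))
      refine h2.congr_deriv ?_
      ring)
    (fun t ht => by
      have ht' : t ∈ Icc (0 : ℝ) T := ⟨ht.1, ht.2.le⟩
      rw [← dist_eq_norm]
      exact ((hF t ht').dist_le_mul _ _).trans
        (mul_le_mul_of_nonneg_left (hseg t ht') hK'.le))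
  -- Evaluating at the maximizer `t₀` gives `N ≤ D + K D T + N/2`.
  have hN2 : N ≤ 2 * (1 + K * T) * D := by
    have h1 := key ht₀
    have h2 : N = Real.exp (-(2 * K * t₀)) * ‖h₁ t₀ - h₂ t₀‖ := rfl
    have h3 : N ≤ Real.exp (-(2 * K * t₀)) *
        (D + K * D * t₀ + N / 2 * Real.exp (2 * K * t₀)) := by
      rw [h2]
      exact mul_le_mul_of_nonneg_left h1 (Real.exp_pos _).le
    have h4 : Real.exp (-(2 * K * t₀)) * Real.exp (2 * K * t₀) = 1 := by
      rw [← Real.exp_add]; simp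
    have h5 : Real.exp (-(2 * K * t₀)) ≤ 1 := by
      rw [Real.exp_le_one_iff]
      have := mul_nonneg hK'.le ht₀.1
      linarith
    have h6 : Real.exp (-(2 * K * t₀)) * (D + K * D * t₀) ≤ D + K * D * T := by
      have h7 : D + K * D * t₀ ≤ D + K * D * T := by
        gcongr
        exact ht₀.2
      have h8 : 0 ≤ D + K * D * t₀ := by
        have := mul_nonneg (mul_nonneg hK'.le hD0) ht₀.1
        linarith
      nlinarith
    have h9 : Real.exp (-(2 * K * t₀)) * (D + K * D * t₀ + N / 2 * Real.exp (2 * K * t₀)) =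
        Real.exp (-(2 * K * t₀)) * (D + K * D * t₀) +
          N / 2 * (Real.exp (-(2 * K * t₀)) * Real.exp (2 * K * t₀)) := by ring
    rw [h9, h4] at h3
    linarith
  rw [dist_eq_norm]
  refine (hle T ⟨hT, le_rfl⟩).trans ?_
  calc N * Real.exp (2 * K * T) ≤ 2 * (1 + K * T) * D * Real.exp (2 * K * T) := by gcongr
    _ = _ := by ring

/-- The input-output map of a neural DDE is Lipschitz continuous, with a constant that depends
only on the bounds on its weights and its vector field. -/
theorem Parameters.Represents.dist_le {d q m : ℕ} {τ T : ℝ} {θ : Parameters d q m τ}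
    {Φ : (Fin d → ℝ) → (Fin q → ℝ)} (hΦ : θ.Represents T Φ) (hτ : 0 ≤ τ) (hT : 0 ≤ T)
    {K : ℝ≥0} (hK : 0 < K) (hF : θ.LipschitzField T K) {w w' : ℝ}
    (hW : ‖θ.W‖ ≤ w) (hW' : ‖θ.W'‖ ≤ w') (x y : Fin d → ℝ) :
    dist (Φ x) (Φ y) ≤ w' * (2 * (1 + K * T) * Real.exp (2 * K * T) * (w * dist x y)) := by
  obtain ⟨h₁, H₁, e₁⟩ := hΦ x
  obtain ⟨h₂, H₂, e₂⟩ := hΦ y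
  have h := H₁.dist_le hτ hT hK hF H₂
  have hw' : 0 ≤ w' := (norm_nonneg _).trans hW'
  rw [e₁, e₂, dist_add_right, dist_eq_norm, ← Matrix.mulVec_sub]
  refine (Matrix.linfty_opNorm_mulVec _ _).trans ?_
  refine mul_le_mul hW' ?_ (norm_nonneg _) hw'
  rw [← dist_eq_norm]
  refine h.trans (mul_le_mul_of_nonneg_left ?_ (by positivity))
  rw [dist_add_right, dist_eq_norm, dist_eq_norm, ← Matrix.mulVec_sub]
  exact (Matrix.linfty_opNorm_mulVec _ _).trans
    (mul_le_mul_of_nonneg_right hW (norm_nonneg _))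

/-- A class of maps with a common Lipschitz constant is not universally approximating: a linear
map of larger slope has infinite distance from all its members. -/
theorem not_universalApproximation_of_dist_le {d q : ℕ} (hd : 1 ≤ d) (hq : 1 ≤ q)
    {N : Set ((Fin d → ℝ) → (Fin q → ℝ))} {L : ℝ}
    (hN : ∀ Φ ∈ N, ∀ x y, dist (Φ x) (Φ y) ≤ L * dist x y) (j : ℕ) :
    ¬ UniversalApproximation N j := by
  intro hU
  let i₀ : Fin d := ⟨0, hd⟩
  let r₀ : Fin q := ⟨0, hq⟩
  -- With error below 1 at each of two points at distance 1, slope `L + 2` forces `Φ` to vary by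
  -- more than `L`.
  obtain ⟨Φ, hΦ, hlt⟩ := hU 1 one_pos (fun x _ => (L + 2) * x i₀) (by fun_prop)
  have hx := hlt (fun _ => 1)
  have h0 := hlt 0
  have hL := hN Φ hΦ (fun _ => 1) 0
  have : Nonempty (Fin d) := ⟨i₀⟩
  have e1 : dist (fun _ => 1 : Fin d → ℝ) 0 = 1 := by
    rw [show (0 : Fin d → ℝ) = fun _ => 0 from rfl, dist_pi_const]; simp
  rw [e1, mul_one] at hL
  have hx' := (dist_le_pi_dist _ _ r₀).trans_lt hx
  have h0' := (dist_le_pi_dist _ _ r₀).trans_lt h0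
  have hL' := (dist_le_pi_dist _ _ r₀).trans hL
  simp only [Real.dist_eq, abs_lt, abs_le, Pi.zero_apply, mul_zero, mul_one, sub_zero]
    at hx' h0' hL'
  linarith [hx'.1, h0'.2, hL'.2]

end Gronwall

/-! ### Bounded derivatives on general normed spaces -/

section BoundedDerivatives

variable {E F G : Type*} [NormedAddCommGroup E] [NormedSpace ℝ E] [NormedAddCommGroup F]
  [NormedSpace ℝ F] [NormedAddCommGroup G] [NormedSpace ℝ G]

/-- `f` is `k` times continuously differentiable, with bounded derivatives of the orders
`1, …, k`. -/
def HasBoundedDerivs (k : ℕ) (f : E → F) : Prop :=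
  ContDiff ℝ k f ∧ ∀ i : ℕ, 1 ≤ i → i ≤ k → ∃ C : ℝ, ∀ x, ‖iteratedFDeriv ℝ i f x‖ ≤ C

theorem HasBoundedDerivs.clm_comp {k : ℕ} {f : E → F} (hf : HasBoundedDerivs k f) (L : F →L[ℝ] G) :
    HasBoundedDerivs k fun x => L (f x) := by
  refine ⟨L.contDiff.comp hf.1, fun i h1 hi => ?_⟩
  obtain ⟨C, hC⟩ := hf.2 i h1 hi
  refine ⟨‖L‖ * C, fun x => ?_⟩
  exact (L.norm_iteratedFDeriv_comp_left hf.1.contDiffAt (by exact_mod_cast hi)).trans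
    (mul_le_mul_of_nonneg_left (hC x) (norm_nonneg _))

theorem HasBoundedDerivs.comp_clm {k : ℕ} {f : E → F} (hf : HasBoundedDerivs k f) (L : G →L[ℝ] E) :
    HasBoundedDerivs k fun x => f (L x) := by
  refine ⟨hf.1.comp L.contDiff, fun i h1 hi => ?_⟩
  obtain ⟨C, hC⟩ := hf.2 i h1 hi
  refine ⟨C * ∏ _j : Fin i, ‖L‖, fun x => ?_⟩
  rw [show (fun x => f (L x)) = f ∘ L from rfl,
    L.iteratedFDeriv_comp_right hf.1 x (by exact_mod_cast hi)]
  refine (ContinuousMultilinearMap.norm_compContinuousLinearMap_le _ _).trans ?_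
  gcongr
  exact hC _

theorem HasBoundedDerivs.sub {k : ℕ} {f g : E → F} (hf : HasBoundedDerivs k f)
    (hg : HasBoundedDerivs k g) : HasBoundedDerivs k fun x => f x - g x := by
  refine ⟨hf.1.sub hg.1, fun i h1 hi => ?_⟩
  obtain ⟨C, hC⟩ := hf.2 i h1 hi
  obtain ⟨C', hC'⟩ := hg.2 i h1 hi
  refine ⟨C + C', fun x => ?_⟩
  have hik : (i : WithTop ℕ∞) ≤ k := by exact_mod_cast hi
  rw [show (fun x => f x - g x) = f - g from rfl,
    iteratedFDeriv_sub_apply (hf.1.of_le hik).contDiffAt (hg.1.of_le hik).contDiffAt]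
  exact (norm_sub_le _ _).trans (add_le_add (hC x) (hC' x))

theorem hasBoundedDerivs_const (k : ℕ) (c : F) : HasBoundedDerivs k fun _ : E => c := by
  refine ⟨contDiff_const, fun i h1 _ => ⟨0, fun x => ?_⟩⟩
  simp [iteratedFDeriv_const_of_ne (Nat.one_le_iff_ne_zero.1 h1)]

theorem hasBoundedDerivs_id (k : ℕ) : HasBoundedDerivs k fun x : E => x := by
  refine ⟨contDiff_id, fun i h1 _ => ?_⟩
  obtain ⟨n, rfl⟩ := Nat.exists_eq_add_of_le' h1
  have h : fderiv ℝ (fun x : E => x) = fun _ => ContinuousLinearMap.id ℝ E := by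
    ext1 x
    exact fderiv_fun_id
  refine ⟨‖ContinuousLinearMap.id ℝ E‖, fun x => ?_⟩
  rw [← norm_iteratedFDeriv_fderiv, h]
  rcases n with _ | n
  · simp only [norm_iteratedFDeriv_zero, le_refl]
  · simp [iteratedFDeriv_const_of_ne (Nat.succ_ne_zero n)]

/-- The vector field `a(t) G(φ(-r))` with a single discrete delay `r = -p` is of class `C^{0,k}_b`. -/
theorem isC0kb_smul_eval {τ T : ℝ} {m k : ℕ} {a : ℝ → ℝ} (ha : Continuous a)
    {g : (Fin m → ℝ) → (Fin m → ℝ)} (hg : HasBoundedDerivs k g) (p : Icc (-τ) (0 : ℝ)) :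
    IsC0kb (τ := τ) T k fun t φ => a t • g (φ p) := by
  have hev : HasBoundedDerivs k fun φ : History τ m => g (φ p) :=
    hg.comp_clm (ContinuousMap.evalCLM ℝ p)
  refine ⟨fun φ => by fun_prop, fun t _ => hev.1.const_smul (a t), fun i h1 hi => ?_⟩
  obtain ⟨C, hC⟩ := hev.2 i h1 hi
  obtain ⟨M, hM⟩ := isCompact_Icc.exists_bound_of_continuousOn (s := Icc (0 : ℝ) T) ha.continuousOn
  refine ⟨M * C, fun t ht φ => ?_⟩
  have hik : (i : WithTop ℕ∞) ≤ k := by exact_mod_cast hi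
  rw [iteratedFDeriv_const_smul_apply' (hev.1.of_le hik).contDiffAt, norm_smul]
  exact mul_le_mul (hM t ht) (hC φ) (norm_nonneg _) ((norm_nonneg _).trans (hM t ht))

end BoundedDerivatives

/-! ### Full-rank weights of prescribed norm -/

section Weights

/-- The scaled partial identity matrix, with `w` on the main diagonal. -/
def padMatrix (d m : ℕ) (w : ℝ) : Matrix (Fin m) (Fin d) ℝ :=
  Matrix.of fun i j => if (i : ℕ) = j then w else 0

/-- The linear map that keeps the first `d` coordinates, padding with zeros where there are
none. -/
def padCLM (m d : ℕ) : (Fin m → ℝ) →L[ℝ] (Fin d → ℝ) :=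
  ContinuousLinearMap.pi fun i =>
    if h : (i : ℕ) < m then ContinuousLinearMap.proj (R := ℝ) ⟨i, h⟩ else 0

theorem padCLM_apply (m d : ℕ) (x : Fin m → ℝ) (i : Fin d) :
    padCLM m d x i = if h : (i : ℕ) < m then x ⟨i, h⟩ else 0 := by
  simp only [padCLM, ContinuousLinearMap.coe_pi']
  split_ifs <;> simp

theorem padMatrix_mulVec (d m : ℕ) (w : ℝ) (x : Fin d → ℝ) :
    (padMatrix d m w).mulVec x = w • padCLM d m x := by
  ext i
  simp only [Matrix.mulVec, dotProduct, padMatrix, Matrix.of_apply, Pi.smul_apply, padCLM_apply,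
    smul_eq_mul, ite_mul, zero_mul]
  split_ifs with h
  · rw [Finset.sum_eq_single ⟨i, h⟩] <;> simp +contextual [Fin.ext_iff, eq_comm]
  · rw [mul_zero]
    refine Finset.sum_eq_zero fun j _ => if_neg fun hj => h ?_
    rw [hj]
    exact j.2

theorem norm_padCLM_apply_le (m d : ℕ) (x : Fin m → ℝ) : ‖padCLM m d x‖ ≤ ‖x‖ := by
  rw [pi_norm_le_iff_of_nonneg (norm_nonneg _)]
  intro i
  rw [padCLM_apply]
  split_ifs
  · exact norm_le_pi_norm x _
  · simp

theorem padCLM_padCLM {m d : ℕ} (h : d ≤ m) (x : Fin d → ℝ) : padCLM m d (padCLM d m x) = x := by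
  ext i
  simp [padCLM_apply, i.2.trans_le h]

/-- A one-sided inverse up to scaling, which forces full rank in both shapes. -/
theorem padMatrix_mul_padMatrix {m d : ℕ} (h : d ≤ m) (w v : ℝ) :
    padMatrix m d v * padMatrix d m w = (v * w) • (1 : Matrix (Fin d) (Fin d) ℝ) := by
  apply Matrix.ext_of_mulVec_single
  intro i
  rw [← Matrix.mulVec_mulVec, padMatrix_mulVec, padMatrix_mulVec, map_smul, padCLM_padCLM h,
    Matrix.smul_mulVec, Matrix.one_mulVec, smul_smul]

theorem norm_padMatrix {m d : ℕ} (hm : 1 ≤ m) (hd : 1 ≤ d) {w : ℝ} (hw : 0 ≤ w) :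
    ‖padMatrix d m w‖ = w := by
  refine le_antisymm ?_ ?_
  · rw [Matrix.linfty_opNorm_eq_opNorm]
    refine ContinuousLinearMap.opNorm_le_bound _ hw fun x => ?_
    change ‖(padMatrix d m w).mulVec x‖ ≤ _
    rw [padMatrix_mulVec, norm_smul, Real.norm_of_nonneg hw]
    exact mul_le_mul_of_nonneg_left (norm_padCLM_apply_le _ _ _) hw
  -- The all-ones vector attains the norm in the first row.
  · have : Nonempty (Fin d) := ⟨⟨0, hd⟩⟩
    have h := Matrix.linfty_opNorm_mulVec (padMatrix d m w) (fun _ => 1)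
    rw [pi_norm_const, norm_one, mul_one] at h
    refine le_trans ?_ ((norm_le_pi_norm _ (⟨0, hm⟩ : Fin m)).trans h)
    rw [padMatrix_mulVec]
    simp [padCLM_apply, Nat.lt_of_succ_le hd, le_abs_self]

theorem rank_padMatrix_of_le {m d : ℕ} (h : d ≤ m) {w : ℝ} (hw : w ≠ 0) :
    (padMatrix d m w).rank = d := by
  refine le_antisymm (Matrix.rank_le_width _) ?_
  have := Matrix.rank_mul_le_right (padMatrix m d w⁻¹) (padMatrix d m w)
  rwa [padMatrix_mul_padMatrix h, inv_mul_cancel₀ hw, one_smul, Matrix.rank_one,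
    Fintype.card_fin] at this

theorem rank_padMatrix_of_ge {m d : ℕ} (h : m ≤ d) {w : ℝ} (hw : w ≠ 0) :
    (padMatrix d m w).rank = m := by
  refine le_antisymm (Matrix.rank_le_height _) ?_
  have := Matrix.rank_mul_le_left (padMatrix d m w) (padMatrix m d w⁻¹)
  rwa [padMatrix_mul_padMatrix h, mul_inv_cancel₀ hw, one_smul, Matrix.rank_one,
    Fintype.card_fin] at this

end Weights

/-! ### Explicit solution driven by a delayed ramp -/

section Ramp

theorem hasDerivAt_max_zero_sq (s : ℝ) :
    HasDerivAt (fun t : ℝ => max t 0 ^ 2) (2 * max s 0) s := by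
  rcases lt_trichotomy s 0 with h | rfl | h
  · rw [max_eq_right h.le, mul_zero]
    refine (hasDerivAt_const s (0 : ℝ)).congr_of_eventuallyEq ?_
    filter_upwards [eventually_lt_nhds h] with t ht
    simp [max_eq_right ht.le]
  · have h : HasDerivAt (fun t : ℝ => max t 0 ^ 2) 0 0 := by
      rw [hasDerivAt_iff_isLittleO]
      simp only [max_self, sub_zero, smul_zero, ne_eq, OfNat.ofNat_ne_zero, not_false_eq_true,
        zero_pow]
      -- At the kink the function is dominated by `t ^ 2`, hence is `o(t)`.
      refine Asymptotics.IsBigO.trans_isLittleO (g := fun t : ℝ => t ^ 2)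
        (Asymptotics.IsBigO.of_bound 1 (Filter.Eventually.of_forall fun t => ?_))
        (Asymptotics.isLittleO_pow_id one_lt_two)
      rw [one_mul, norm_pow, norm_pow]
      gcongr
      rcases le_total t 0 with h | h <;> simp [h]
    simpa using h
  · rw [max_eq_left h.le]
    have := (hasDerivAt_pow 2 s)
    simp only [Nat.cast_ofNat, Nat.add_one_sub_one, pow_one] at this
    refine this.congr_of_eventuallyEq ?_
    filter_upwards [eventually_gt_nhds h] with t ht
    simp [max_eq_left ht.le]

/-- For `a(t) = 2 (t-(T-τ))⁺ / τ²`, the delay equation `h'(t) = a(t) g(h(t-τ))` is solved by a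
function that is constant until `T - τ` and then moves by `g y`. -/
theorem exists_isSolution_ramp {τ T : ℝ} (hτ : 0 < τ) (hτT : τ ≤ T) {m : ℕ}
    (g : (Fin m → ℝ) → (Fin m → ℝ)) (y : Fin m → ℝ) (p : Icc (-τ) (0 : ℝ)) (hp : (p : ℝ) = -τ) :
    ∃ h : C(ℝ, Fin m → ℝ),
      IsSolution τ T (fun t φ => (2 / τ ^ 2 * max (t - (T - τ)) 0) • g (φ p)) y h ∧
        h T = y + g y := by
  let h : C(ℝ, Fin m → ℝ) :=
    ⟨fun t => y + (max (t - (T - τ)) 0 ^ 2 / τ ^ 2) • g y, by fun_prop⟩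
  have h_apply : ∀ t, h t = y + (max (t - (T - τ)) 0 ^ 2 / τ ^ 2) • g y := fun _ => rfl
  have h_const : ∀ t, t ≤ T - τ → h t = y := by
    intro t ht
    rw [h_apply, max_eq_right (by linarith)]
    simp
  refine ⟨h, ⟨fun s hs => h_const s (by linarith [hs.2]), fun t ht => ?_⟩, ?_⟩
  -- Since `t - τ ≤ T - τ`, the delayed argument only sees the constant part.
  · have e : segment τ h t p = y := by
      change h (t + p) = y
      exact h_const _ (by rw [hp]; linarith [ht.2])
    simp only [e]
    have h1 : HasDerivAt (fun t : ℝ => max (t - (T - τ)) 0 ^ 2)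
        (2 * max (t - (T - τ)) 0) t :=
      (hasDerivAt_max_zero_sq (t - (T - τ))).comp_sub_const t (T - τ)
    have h2 := ((h1.div_const (τ ^ 2)).smul_const (g y)).const_add y
    refine HasDerivAt.hasDerivWithinAt (h2.congr_deriv ?_)
    congr 1
    ring
  · rw [h_apply, max_eq_left (by linarith), show T - (T - τ) = τ by ring,
      div_self (by positivity), one_smul]

end Ramp

/-! ### Exact representation of the target map -/

section Representation

/-- The vector by which `y = W x` has to be moved to reach a point that `W'` maps to
`Ψ x - Ψ 0`, where `W` and `W'` are the scaled partial identities. -/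
noncomputable def displacement {d q : ℕ} (m : ℕ) (w w' : ℝ) (Ψ : (Fin d → ℝ) → (Fin q → ℝ)) (y : Fin m → ℝ) :
    Fin m → ℝ :=
  (w'⁻¹ • padCLM q m) (Ψ ((w⁻¹ • padCLM m d) y)) - (w'⁻¹ • padCLM q m) (Ψ 0) - y

theorem hasBoundedDerivs_displacement {d q k : ℕ} (m : ℕ) (w w' : ℝ)
    {Ψ : (Fin d → ℝ) → (Fin q → ℝ)} (hΨ : IsCkb k Ψ) :
    HasBoundedDerivs k (displacement m w w' Ψ) := by
  have h : HasBoundedDerivs k Ψ := hΨ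
  exact (((h.comp_clm (w⁻¹ • padCLM m d)).clm_comp (w'⁻¹ • padCLM q m)).sub
    (hasBoundedDerivs_const k _)).sub (hasBoundedDerivs_id k)

/-- Subtracting `Ψ 0` makes the field vanish at the zero history, so any `A ≥ 0` is admissible; the
output bias restores it. -/
theorem displacement_zero {d q : ℕ} (m : ℕ) (w w' : ℝ) (Ψ : (Fin d → ℝ) → (Fin q → ℝ)) :
    displacement m w w' Ψ 0 = 0 := by
  simp [displacement]

/-- The summand 1 comes from subtracting `y`; the other is the product of the constants `w'⁻¹`, `L`,
`w⁻¹` of the composed maps. -/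
theorem dist_displacement_le {d q : ℕ} (m : ℕ) {w w' : ℝ} (hw : 0 < w) (hw' : 0 < w')
    {Ψ : (Fin d → ℝ) → (Fin q → ℝ)} {L : ℝ≥0} (hΨ : LipschitzWith L Ψ) (y z : Fin m → ℝ) :
    dist (displacement m w w' Ψ y) (displacement m w w' Ψ z) ≤
      (1 + L / (w * w')) * dist y z := by
  have h1 : ∀ (n l : ℕ) (c : ℝ), 0 < c → ∀ u v : Fin n → ℝ,
      dist ((c⁻¹ • padCLM n l) u) ((c⁻¹ • padCLM n l) v) ≤ c⁻¹ * dist u v := by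
    intro n l c hc u v
    rw [dist_eq_norm, ← map_sub, dist_eq_norm, smul_apply, norm_smul,
      Real.norm_of_nonneg (by positivity)]
    exact mul_le_mul_of_nonneg_left (norm_padCLM_apply_le _ _ _) (by positivity)
  unfold displacement
  refine (dist_sub_sub_le _ _ _ _).trans ?_
  rw [dist_sub_right]
  have h2 := h1 q m w' hw' (Ψ ((w⁻¹ • padCLM m d) y)) (Ψ ((w⁻¹ • padCLM m d) z))
  have h3 := hΨ.dist_le_mul ((w⁻¹ • padCLM m d) y) ((w⁻¹ • padCLM m d) z)
  have h4 := h1 m d w hw y z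
  have h5 : w'⁻¹ * dist (Ψ ((w⁻¹ • padCLM m d) y)) (Ψ ((w⁻¹ • padCLM m d) z)) ≤
      w'⁻¹ * (L * (w⁻¹ * dist y z)) :=
    mul_le_mul_of_nonneg_left (h3.trans (mul_le_mul_of_nonneg_left h4 L.2)) (by positivity)
  have h6 : w'⁻¹ * (L * (w⁻¹ * dist y z)) = L / (w * w') * dist y z := by
    field_simp
  linarith

theorem exists_parameters_represents {d q k : ℕ} (hd : 1 ≤ d) (hq : 1 ≤ q)
    {T : ℝ} {w w' : ℝ} (hw : 0 < w) (hw' : 0 < w') {A : ℝ} (hA : 0 ≤ A)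
    {Ψ : (Fin d → ℝ) → (Fin q → ℝ)} {L : ℝ≥0} (hΨ : IsCkb k Ψ) (hL : LipschitzWith L Ψ)
    {K : ℝ≥0} {τ : ℝ} (hτ : 0 ≤ τ) (hτT : τ ≤ T) (hK : 2 * (1 + L / (w * w')) ≤ K * τ) :
    ∃ θ : Parameters d q (max d q) τ,
      IsC0kb T k θ.F ∧ θ.NonAugmented ∧ θ.LipschitzField T K ∧
      θ.FieldBoundAtZero T A ∧ ‖θ.W‖ = w ∧ ‖θ.W'‖ = w' ∧ θ.Represents T Ψ := by
  have hL0 : 0 ≤ (L : ℝ) / (w * w') := by positivity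
  have hτ0 : 0 < τ := by
    refine lt_of_le_of_ne hτ fun h => ?_
    rw [← h, mul_zero] at hK
    linarith
  set m := max d q
  have hdm : d ≤ m := le_max_left d q
  have hqm : q ≤ m := le_max_right d q
  let p : Icc (-τ) (0 : ℝ) := ⟨-τ, le_rfl, by linarith⟩
  let g := displacement m w w' Ψ
  let a : ℝ → ℝ := fun t => 2 / τ ^ 2 * max (t - (T - τ)) 0
  refine ⟨⟨padMatrix d m w, 0, padMatrix m q w', Ψ 0, fun t φ => a t • g (φ p)⟩, ?_,
    ⟨le_rfl, ?_, ?_⟩, ?_, ?_, ?_, ?_, ?_⟩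
  · exact isC0kb_smul_eval (by fun_prop) (hasBoundedDerivs_displacement m w w' hΨ) p
  · rw [min_eq_right hdm]
    exact rank_padMatrix_of_le hdm hw.ne'
  · rw [min_eq_left hqm]
    exact rank_padMatrix_of_ge hqm hw'.ne'
  · intro t ht
    refine LipschitzWith.of_dist_le_mul fun φ ψ => ?_
    have ha0 : 0 ≤ a t := by positivity
    -- The ramp is largest at `t = T`: a triangle of base `τ` and area 1 has height `2/τ`.
    have ha : a t ≤ 2 / τ := by
      have h1 : max (t - (T - τ)) 0 ≤ τ := max_le (by linarith [ht.2]) hτ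
      calc a t ≤ 2 / τ ^ 2 * τ := by simp only [a]; gcongr
        _ = 2 / τ := by field_simp
    have hK' : 2 / τ * (1 + L / (w * w')) ≤ K := by
      rw [div_mul_eq_mul_div, div_le_iff₀ hτ0]
      exact hK
    change dist (a t • g (φ p)) (a t • g (ψ p)) ≤ _
    rw [dist_smul₀, Real.norm_of_nonneg ha0]
    calc a t * dist (g (φ p)) (g (ψ p))
        ≤ 2 / τ * ((1 + L / (w * w')) * dist (φ p) (ψ p)) := by
          gcongr
          exact dist_displacement_le m hw hw' hL _ _
      _ = 2 / τ * (1 + L / (w * w')) * dist (φ p) (ψ p) := by ring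
      _ ≤ K * dist φ ψ := by
          gcongr
          exact ContinuousMap.dist_apply_le_dist p
  · intro t _
    change ‖a t • g 0‖ ≤ A
    rw [show g 0 = 0 from displacement_zero m w w' Ψ, smul_zero, norm_zero]
    exact hA
  · exact norm_padMatrix (hd.trans hdm) hd hw.le
  · exact norm_padMatrix hq (hd.trans hdm) hw'.le
  · intro x
    obtain ⟨h, hsol, hT⟩ := exists_isSolution_ramp hτ0 hτT g
      ((padMatrix d m w).mulVec x + 0) p rfl
    refine ⟨h, hsol, ?_⟩
    have e : h T = (w'⁻¹ • padCLM q m) (Ψ x) - (w'⁻¹ • padCLM q m) (Ψ 0) := by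
      rw [hT]
      simp only [g, displacement, add_zero, padMatrix_mulVec, smul_apply,
        map_smul, smul_smul, padCLM_padCLM hdm, mul_inv_cancel₀ hw.ne', one_smul]
      abel
    simp only [e, padMatrix_mulVec, map_sub, smul_apply, map_smul,
      padCLM_padCLM hqm, smul_sub, smul_smul, mul_inv_cancel₀ hw'.ne', one_smul, sub_add_cancel]

end Representation

end NeuralDelay

theorem mainTheorem3 (d q k : ℕ) (hd : 1 ≤ d) (hq : 1 ≤ q) (hk : 1 ≤ k)
    (T : ℝ) (hT : 0 < T) (w w' : ℝ) (hw : 0 < w) (hw' : 0 < w') (A : ℝ) (hA : 0 ≤ A) :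
    (∃ τ₀ : ℝ → ℝ, ContinuousOn τ₀ (Set.Ioi 0) ∧
      (∀ K : ℝ, 0 < K → 0 < τ₀ K ∧ τ₀ K ≤ T ∧ K * τ₀ K * Real.exp 1 < 1) ∧
      ∀ K : NNReal, 0 < K → ∀ τ : ℝ, 0 ≤ τ → τ < τ₀ K → ∀ j : ℕ,
        ¬ NeuralDelay.UniversalApproximation
          {Φ : (Fin d → ℝ) → (Fin q → ℝ) |
            ∃ θ : NeuralDelay.Parameters d q (max d q) τ,
              NeuralDelay.IsC0kb T k θ.F ∧ θ.NonAugmented ∧ θ.LipschitzField T K ∧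
              θ.FieldBoundAtZero T A ∧ ‖θ.W‖ ≤ w ∧ ‖θ.W'‖ ≤ w' ∧ θ.Represents T Φ} j) ∧
    (∀ (Ψ : (Fin d → ℝ) → (Fin q → ℝ)) (KΨ : NNReal),
      NeuralDelay.IsCkb k Ψ → LipschitzWith KΨ Ψ →
      ∀ (K : NNReal) (τ : ℝ), 0 ≤ τ → τ ≤ T → 2 * (1 + KΨ / (w * w')) ≤ K * τ →
        ∃ θ : NeuralDelay.Parameters d q (max d q) τ,
          NeuralDelay.IsC0kb T k θ.F ∧ θ.NonAugmented ∧ θ.LipschitzField T K ∧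
          θ.FieldBoundAtZero T A ∧ ‖θ.W‖ = w ∧ ‖θ.W'‖ = w' ∧ θ.Represents T Ψ) := by
  refine ⟨⟨fun K => min T (2 * K * Real.exp 1)⁻¹, ?_, ?_, ?_⟩, ?_⟩
  -- The factor 2 in `τ₀` gives `K τ₀(K) e ≤ 1/2`, hence the strict inequality.
  · refine ContinuousOn.inf continuousOn_const (ContinuousOn.inv₀ (by fun_prop) fun K hK => ?_)
    have : (0 : ℝ) < K := hK
    positivity
  · intro K hK
    refine ⟨by positivity, min_le_left _ _, ?_⟩
    have h : min T (2 * K * Real.exp 1)⁻¹ ≤ (2 * K * Real.exp 1)⁻¹ := min_le_right _ _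
    calc K * min T (2 * K * Real.exp 1)⁻¹ * Real.exp 1
        ≤ K * (2 * K * Real.exp 1)⁻¹ * Real.exp 1 := by gcongr
      _ = 1 / 2 := by field_simp
      _ < 1 := by norm_num
  · intro K hK τ hτ _ j
    refine NeuralDelay.not_universalApproximation_of_dist_le hd hq
      (L := w' * (2 * (1 + K * T) * Real.exp (2 * K * T) * w)) ?_ j
    rintro Φ ⟨θ, -, -, hF, -, hW, hW', hΦ⟩ x y
    refine (hΦ.dist_le hτ hT.le hK hF hW hW' x y).trans_eq ?_
    ring
  · intro Ψ KΨ hΨ hL K τ hτ hτT hK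
    exact NeuralDelay.exists_parameters_represents hd hq hw hw' hA hΨ hL hτ hτT hK
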